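/- Let $\lambda,\mu,\nu,T>0$. Consider the scaled number $x_1(t)$ of excited atoms and the scaled numbers $x_2(t)$, $x_3(t)$ of photons emitted spontaneously and by stimulation up to time $t\in[0,T]$, in the system of two-level atoms with excitation rate $\lambda$, spontaneous emission rate $\mu$ and stimulated emission rate $\nu$ (each stimulated emission releases two photons). For $C^1$ paths $(x_1,x_2,x_3):[0,T]\to\mathbb R_+^3$ with $x_2(0)=x_3(0)=0$, the large-deviation rate function is $$I(x_1,x_2,x_3)=\int_0^T\sup_{\varkappa_1,\varkappa_2,\varkappa_3\in\mathbb R}\Bigl(\varkappa_1\dot x_1+\varkappa_2\dot x_2+\varkappa_3\dot x_3-\lambda(1-x_1)[e^{\varkappa_1}-1]-\mu x_1[e^{-\varkappa_1+\varkappa_2}-1]-\nu x_1[e^{-\varkappa_1+2\varkappa_3}-1]\Bigr)\,dt\in[0,\infty].$$ For $u\in[0,1]$ and $B>0$, call a path optimal if it minimises $I$ among all such paths with $x_1(0)=u$ and total emission $x_2(T)+x_3(T)=B$. Then, for all sufficiently large $B$ (uniformly in $u\in[0,1]$), an optimal path exists, every optimal path has $x_3(T)>0$, and $$\lim_{B\to\infty}\frac{x_2(T)}{x_3(T)}=0$$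 along optimal paths, uniformly in the choice of the optimal path and of $u\in[0,1]$. The same holds if the constraint $x_2(T)+x_3(T)=B$ is replaced by $x_2(T)+x_3(T)\ge B$. -/

import Mathlib

open Set
open scoped ENNReal

noncomputable section

/-- A triple of functions of time: `x₁` is the fraction of excited atoms, `x₂` and `x₃` are the
numbers, per atom, of spontaneously and of stimulatedly emitted photons. Only the values on
`[0, T]` matter below. -/
structure EmissionPath where
  x₁ : ℝ → ℝ
  x₂ : ℝ → ℝ
  x₃ : ℝ → ℝ

/-- The Hamiltonian
`H = λ (1 - x₁) (e^{k₁} - 1) + μ x₁ (e^{-k₁ + k₂} - 1) + ν x₁ (e^{-k₁ + 2 k₃} - 1)`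
of the scaled jump process with jumps `(1, 0, 0)`, `(-1, 1, 0)`, `(-1, 0, 2)` at rates
`λ (1 - x₁)`, `μ x₁`, `ν x₁`. -/
def emissionHamiltonian (lam μ ν x₁ k₁ k₂ k₃ : ℝ) : ℝ :=
  lam * (1 - x₁) * (Real.exp k₁ - 1)
    + μ * x₁ * (Real.exp (-k₁ + k₂) - 1)
    + ν * x₁ * (Real.exp (-k₁ + 2 * k₃) - 1)

/-- The local rate: the Legendre transform of the Hamiltonian, with values in `[0, ∞]`.
The bracket vanishes at `k = 0`, so its supremum is nonnegative, and truncating the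
bracket at `0` by `ENNReal.ofReal` does not change the supremum. -/
def emissionLagrangian (lam μ ν x₁ v₁ v₂ v₃ : ℝ) : ℝ≥0∞ :=
  ⨆ (k₁ : ℝ) (k₂ : ℝ) (k₃ : ℝ),
    ENNReal.ofReal (k₁ * v₁ + k₂ * v₂ + k₃ * v₃ - emissionHamiltonian lam μ ν x₁ k₁ k₂ k₃)

/-- The rate function `I(x₁, x₂, x₃)` on `[0, T]`, with values in `[0, ∞]`. -/
def emissionRate (lam μ ν T : ℝ) (x : EmissionPath) : ℝ≥0∞ :=
  ∫⁻ t in Icc (0 : ℝ) T,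
    emissionLagrangian lam μ ν (x.x₁ t)
      (derivWithin x.x₁ (Icc 0 T) t)
      (derivWithin x.x₂ (Icc 0 T) t)
      (derivWithin x.x₃ (Icc 0 T) t)

/-- Continuously differentiable paths `[0, T] → ℝ₊³` that start with the fraction `u` of excited
atoms and no emitted photons, and whose total emission `x₂(T) + x₃(T)` lies in `S`. -/
structure IsAdmissiblePath (T u : ℝ) (S : Set ℝ) (x : EmissionPath) : Prop where
  contDiffOn₁ : ContDiffOn ℝ 1 x.x₁ (Icc 0 T)
  contDiffOn₂ : ContDiffOn ℝ 1 x.x₂ (Icc 0 T)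
  contDiffOn₃ : ContDiffOn ℝ 1 x.x₃ (Icc 0 T)
  nonneg : ∀ t ∈ Icc 0 T, 0 ≤ x.x₁ t ∧ 0 ≤ x.x₂ t ∧ 0 ≤ x.x₃ t
  init₁ : x.x₁ 0 = u
  init₂ : x.x₂ 0 = 0
  init₃ : x.x₃ 0 = 0
  emission_mem : x.x₂ T + x.x₃ T ∈ S

/-- An optimal path: it minimises the rate function among the admissible paths. -/
def IsOptimalPath (lam μ ν T u : ℝ) (S : Set ℝ) (x : EmissionPath) : Prop :=
  IsAdmissiblePath T u S x ∧
    ∀ y : EmissionPath, IsAdmissiblePath T u S y →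
      emissionRate lam μ ν T x ≤ emissionRate lam μ ν T y

end

namespace Emission

open MeasureTheory Filter Topology

/-! ### Duality and the verification of extremals -/

/-! The proof is convex duality with an explicit multiplier; it never needs the optimal path to be
unique. Bounding the local rate below by the bracket at dual variables `(k t, κ, κ)` bounds `I` from
below. Since the Hamiltonian is affine in `x₁`, a costate (`k' = -∂H/∂x₁`, `k T = 0`) removes the
path from this bound except through its total emission. A path whose velocity is the gradient of the
Hamiltonian attains the bound, hence is optimal for its own total emission `B`, and also for
emission at least `B` when `κ ≥ 0` (`IsExtremal.optimal`).

Any other optimal path attains the same bound. Moving the multipliers of `x₂` and `x₃` separately,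
as constants, still gives valid bounds, and the first-order conditions at zero shift force `x₂ T = μ
e^κ Q` and `x₃ T = 2 ν e^(2κ) Q` (`IsCostate.emissions_of_emissionRate_le`). The ratio is then `μ
e^(-κ) / (2 ν)`, so it remains to show that large `B` forces large `κ`, uniformly in `u`.

The costate equation is a Riccati equation, linearised by `e^k = h₁ / h₀` with `(h₀, h₁)` solving a
two-state linear system; `x₁ = p₁ h₁` with `p` solving the adjoint system. The emission of this
extremal is continuous in `κ` and tends to infinity (`eventually_le_totalEmission`), so the
intermediate value theorem finds a multiplier above any prescribed `κ₀` once `B` exceeds the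
emission at `κ₀`, which is bounded over `u ∈ [0, 1]`. -/

/-- The expression `k · v - H(x₁, k)` whose supremum over `k` is the local rate. -/
noncomputable def bracket (lam μ ν x₁ v₁ v₂ v₃ k₁ k₂ k₃ : ℝ) : ℝ :=
  k₁ * v₁ + k₂ * v₂ + k₃ * v₃ - emissionHamiltonian lam μ ν x₁ k₁ k₂ k₃

theorem ofReal_bracket_le_emissionLagrangian (lam μ ν x₁ v₁ v₂ v₃ k₁ k₂ k₃ : ℝ) :
    ENNReal.ofReal (bracket lam μ ν x₁ v₁ v₂ v₃ k₁ k₂ k₃)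
      ≤ emissionLagrangian lam μ ν x₁ v₁ v₂ v₃ :=
  le_iSup_of_le k₁ (le_iSup_of_le k₂ (le_iSup_of_le k₃ le_rfl))

/-- The tangent line inequality for `c * exp` at `b`. -/
theorem mul_exp_tangent_le {c : ℝ} (hc : 0 ≤ c) (a b : ℝ) :
    c * Real.exp b + c * Real.exp b * (a - b) ≤ c * Real.exp a := by
  have h := Real.add_one_le_exp (a - b)
  have h2 : Real.exp a = Real.exp b * Real.exp (a - b) := by
    rw [← Real.exp_add]; congr 1; ring
  rw [h2]
  nlinarith [mul_le_mul_of_nonneg_left h (mul_nonneg hc (Real.exp_pos b).le)]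

/-- The bracket is maximal where the velocity is the gradient of the Hamiltonian. -/
theorem bracket_le_bracket_of_gradient {lam μ ν x k₁ k₂ k₃ v₁ v₂ v₃ : ℝ} (hlam : 0 ≤ lam)
    (hμ : 0 ≤ μ) (hν : 0 ≤ ν) (hx₀ : 0 ≤ x) (hx₁ : x ≤ 1)
    (h₁ : v₁ = lam * (1 - x) * Real.exp k₁ - μ * x * Real.exp (-k₁ + k₂)
      - ν * x * Real.exp (-k₁ + 2 * k₃))
    (h₂ : v₂ = μ * x * Real.exp (-k₁ + k₂)) (h₃ : v₃ = 2 * (ν * x * Real.exp (-k₁ + 2 * k₃)))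
    (j₁ j₂ j₃ : ℝ) :
    bracket lam μ ν x v₁ v₂ v₃ j₁ j₂ j₃ ≤ bracket lam μ ν x v₁ v₂ v₃ k₁ k₂ k₃ := by
  have e₁ := mul_exp_tangent_le (mul_nonneg hlam (sub_nonneg.2 hx₁)) j₁ k₁
  have e₂ := mul_exp_tangent_le (mul_nonneg hμ hx₀) (-j₁ + j₂) (-k₁ + k₂)
  have e₃ := mul_exp_tangent_le (mul_nonneg hν hx₀) (-j₁ + 2 * j₃) (-k₁ + 2 * k₃)
  subst h₁ h₂ h₃
  unfold bracket emissionHamiltonian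
  linarith

theorem emissionLagrangian_eq_of_gradient {lam μ ν x k₁ k₂ k₃ v₁ v₂ v₃ : ℝ} (hlam : 0 ≤ lam)
    (hμ : 0 ≤ μ) (hν : 0 ≤ ν) (hx₀ : 0 ≤ x) (hx₁ : x ≤ 1)
    (h₁ : v₁ = lam * (1 - x) * Real.exp k₁ - μ * x * Real.exp (-k₁ + k₂)
      - ν * x * Real.exp (-k₁ + 2 * k₃))
    (h₂ : v₂ = μ * x * Real.exp (-k₁ + k₂)) (h₃ : v₃ = 2 * (ν * x * Real.exp (-k₁ + 2 * k₃))) :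
    emissionLagrangian lam μ ν x v₁ v₂ v₃
      = ENNReal.ofReal (bracket lam μ ν x v₁ v₂ v₃ k₁ k₂ k₃) := by
  refine le_antisymm ?_ (ofReal_bracket_le_emissionLagrangian ..)
  exact iSup_le fun j₁ => iSup_le fun j₂ => iSup_le fun j₃ => ENNReal.ofReal_le_ofReal
    (bracket_le_bracket_of_gradient hlam hμ hν hx₀ hx₁ h₁ h₂ h₃ j₁ j₂ j₃)

theorem bracket_zero (lam μ ν x v₁ v₂ v₃ : ℝ) : bracket lam μ ν x v₁ v₂ v₃ 0 0 0 = 0 := by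
  simp [bracket, emissionHamiltonian]

/-- The bracket along a path, for a time-dependent first and constant other dual variables. -/
noncomputable def pathBracket (lam μ ν T : ℝ) (x : EmissionPath) (k : ℝ → ℝ) (k₂ k₃ t : ℝ) : ℝ :=
  bracket lam μ ν (x.x₁ t) (derivWithin x.x₁ (Icc 0 T) t) (derivWithin x.x₂ (Icc 0 T) t)
    (derivWithin x.x₃ (Icc 0 T) t) (k t) k₂ k₃

theorem continuousOn_pathBracket {lam μ ν T u : ℝ} (hT : 0 < T) {S : Set ℝ} {x : EmissionPath}
    (hx : IsAdmissiblePath T u S x) {k : ℝ → ℝ} (hk : ContinuousOn k (Icc 0 T)) (k₂ k₃ : ℝ) :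
    ContinuousOn (pathBracket lam μ ν T x k k₂ k₃) (Icc 0 T) := by
  have hU := uniqueDiffOn_Icc hT
  have c₁ := hx.contDiffOn₁.continuousOn
  have d₁ := hx.contDiffOn₁.continuousOn_derivWithin hU le_rfl
  have d₂ := hx.contDiffOn₂.continuousOn_derivWithin hU le_rfl
  have d₃ := hx.contDiffOn₃.continuousOn_derivWithin hU le_rfl
  unfold pathBracket bracket emissionHamiltonian
  fun_prop

/-- Weak duality: every choice of dual variables bounds the rate function from below. -/
theorem ofReal_integral_pathBracket_le {lam μ ν T u : ℝ} (hT : 0 < T) {S : Set ℝ}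
    {x : EmissionPath} (hx : IsAdmissiblePath T u S x) {k : ℝ → ℝ}
    (hk : ContinuousOn k (Icc 0 T)) (k₂ k₃ : ℝ) :
    ENNReal.ofReal (∫ t in (0 : ℝ)..T, pathBracket lam μ ν T x k k₂ k₃ t)
      ≤ emissionRate lam μ ν T x := by
  have hc := continuousOn_pathBracket (lam := lam) (μ := μ) (ν := ν) hT hx hk k₂ k₃
  have hi : IntegrableOn (pathBracket lam μ ν T x k k₂ k₃) (Icc 0 T) :=
    hc.integrableOn_compact isCompact_Icc
  rw [intervalIntegral.integral_of_le hT.le, ← integral_Icc_eq_integral_Ioc]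
  -- For arbitrary dual variables the bracket may be negative at some times, so it is replaced by
  -- its positive part before passing to `∫⁻`.
  calc _ ≤ ENNReal.ofReal (∫ t in Icc 0 T, max (pathBracket lam μ ν T x k k₂ k₃ t) 0) :=
        ENNReal.ofReal_le_ofReal (integral_mono hi hi.pos_part fun t => le_max_left _ _)
    _ = ∫⁻ t in Icc 0 T, ENNReal.ofReal (max (pathBracket lam μ ν T x k k₂ k₃ t) 0) :=
        ofReal_integral_eq_lintegral_ofReal hi.pos_part (ae_of_all _ fun t => le_max_right _ _)
    _ ≤ _ := by
        refine lintegral_mono fun t => ?_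
        rw [ENNReal.ofReal_max, ENNReal.ofReal_zero, max_eq_left (zero_le)]
        exact ofReal_bracket_le_emissionLagrangian ..

/-- The costate equation `k' = -∂H/∂x₁` with free terminal state, for the dual variables
`k₂ = k₃ = κ`. -/
structure IsCostate (lam μ ν T κ : ℝ) (k : ℝ → ℝ) : Prop where
  hasDerivAt : ∀ t ∈ Icc 0 T, HasDerivAt k (lam * (Real.exp (k t) - 1)
    - μ * (Real.exp (-k t + κ) - 1) - ν * (Real.exp (-k t + 2 * κ) - 1)) t
  terminal : k T = 0

theorem IsCostate.continuousOn {lam μ ν T κ : ℝ} {k : ℝ → ℝ} (h : IsCostate lam μ ν T κ k) :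
    ContinuousOn k (Icc 0 T) :=
  fun t ht => (h.hasDerivAt t ht).continuousAt.continuousWithinAt

theorem hasDerivAt_of_contDiffOn_Icc {T t : ℝ} {f : ℝ → ℝ} (hf : ContDiffOn ℝ 1 f (Icc 0 T))
    (ht : t ∈ Ioo 0 T) : HasDerivAt f (derivWithin f (Icc 0 T) t) t :=
  ((hf.differentiableOn one_ne_zero t (Ioo_subset_Icc_self ht)).hasDerivWithinAt).hasDerivAt
    (Icc_mem_nhds ht.1 ht.2)

/-- The dual bound given by a costate, with the dual variables `k₂` and `k₃` moved from `κ` by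
constants. -/
theorem IsCostate.integral_pathBracket {lam μ ν T κ u : ℝ} {k : ℝ → ℝ}
    (h : IsCostate lam μ ν T κ k) (hT : 0 < T) {S : Set ℝ} {x : EmissionPath}
    (hx : IsAdmissiblePath T u S x) (δ₂ δ₃ : ℝ) :
    ∫ t in (0 : ℝ)..T, pathBracket lam μ ν T x k (κ + δ₂) (κ + δ₃) t
      = κ * (x.x₂ T + x.x₃ T) - k 0 * u - (∫ t in (0 : ℝ)..T, lam * (Real.exp (k t) - 1))
        + (δ₂ * x.x₂ T
          - (Real.exp δ₂ - 1) * (μ * Real.exp κ * ∫ t in (0 : ℝ)..T, x.x₁ t * Real.exp (-k t)))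
        + (δ₃ * x.x₃ T - (Real.exp (2 * δ₃) - 1)
          * (ν * Real.exp (2 * κ) * ∫ t in (0 : ℝ)..T, x.x₁ t * Real.exp (-k t))) := by
  have hk := h.continuousOn
  have c₁ := hx.contDiffOn₁.continuousOn
  have c₂ := hx.contDiffOn₂.continuousOn
  have c₃ := hx.contDiffOn₃.continuousOn
  have hg := continuousOn_pathBracket (lam := lam) (μ := μ) (ν := ν) hT hx hk (κ + δ₂) (κ + δ₃)
  have ce : ContinuousOn (fun t => lam * (Real.exp (k t) - 1)) (Icc 0 T) := by fun_prop
  have cq : ContinuousOn (fun t => x.x₁ t * Real.exp (-k t)) (Icc 0 T) := by fun_prop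
  have ig := hg.intervalIntegrable_of_Icc (μ := volume) hT.le
  have ie := ce.intervalIntegrable_of_Icc (μ := volume) hT.le
  have iq := cq.intervalIntegrable_of_Icc (μ := volume) hT.le
  set A := (Real.exp δ₂ - 1) * (μ * Real.exp κ) + (Real.exp (2 * δ₃) - 1) * (ν * Real.exp (2 * κ))
    with hA
  -- In the derivative of the pairing of dual variables with the path, the costate equation cancels
  -- the `x₁` terms of the Hamiltonian at `κ`. What survives is its value at `x₁ = 0` and the effect
  -- `A` of the shifts.
  have key := intervalIntegral.integral_eq_sub_of_hasDerivAt_of_le (a := 0) (b := T) hT.le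
    (f := fun t => k t * x.x₁ t + (κ + δ₂) * x.x₂ t + (κ + δ₃) * x.x₃ t)
    (f' := fun t => pathBracket lam μ ν T x k (κ + δ₂) (κ + δ₃) t + lam * (Real.exp (k t) - 1)
      + A * (x.x₁ t * Real.exp (-k t))) (by fun_prop) ?_ ((ig.add ie).add (iq.const_mul A))
  · rw [intervalIntegral.integral_add (ig.add ie) (iq.const_mul A),
      intervalIntegral.integral_add ig ie, intervalIntegral.integral_const_mul A,
      hx.init₁, hx.init₂, hx.init₃, h.terminal] at key
    rw [hA] at key
    linear_combination key
  · intro t ht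
    have hd := (((h.hasDerivAt t (Ioo_subset_Icc_self ht)).mul
      (hasDerivAt_of_contDiffOn_Icc hx.contDiffOn₁ ht)).add
      ((hasDerivAt_of_contDiffOn_Icc hx.contDiffOn₂ ht).const_mul (κ + δ₂))).add
      ((hasDerivAt_of_contDiffOn_Icc hx.contDiffOn₃ ht).const_mul (κ + δ₃))
    refine hd.congr_deriv ?_
    simp only [pathBracket, bracket, emissionHamiltonian, hA, mul_add, Real.exp_add]
    ring

/-- If `δ A ≤ (exp (c δ) - 1) B` for all `δ`, then the two sides have the same slope at `0`. -/
theorem eq_of_forall_mul_le_exp_sub_one {A B c : ℝ}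
    (h : ∀ δ : ℝ, δ * A ≤ (Real.exp (c * δ) - 1) * B) : A = c * B := by
  have hd : HasDerivAt (fun δ : ℝ => (Real.exp (c * δ) - 1) * B - δ * A) (c * B - A) 0 := by
    have h1 : HasDerivAt (fun δ : ℝ => c * δ) c 0 := by
      simpa using (hasDerivAt_id (0 : ℝ)).const_mul c
    have := ((h1.exp.sub_const 1).mul_const B).sub ((hasDerivAt_id (0 : ℝ)).mul_const A)
    refine this.congr_deriv ?_
    simp
  have hm : IsLocalMin (fun δ : ℝ => (Real.exp (c * δ) - 1) * B - δ * A) 0 :=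
    Eventually.of_forall fun δ => by simpa using h δ
  linarith [hm.hasDerivAt_eq_zero hd]

/-- A path that attains the dual bound emits in the proportions prescribed by the dual
variables. -/
theorem IsCostate.emissions_of_emissionRate_le {lam μ ν T κ u B : ℝ} {k : ℝ → ℝ}
    (h : IsCostate lam μ ν T κ k) (hT : 0 < T) (hκ : 0 ≤ κ) {S : Set ℝ} {x : EmissionPath}
    (hx : IsAdmissiblePath T u S x) (hS : ∀ b ∈ S, B ≤ b)
    (hpos : 0 ≤ κ * B - k 0 * u - ∫ t in (0 : ℝ)..T, lam * (Real.exp (k t) - 1))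
    (hle : emissionRate lam μ ν T x ≤ ENNReal.ofReal
      (κ * B - k 0 * u - ∫ t in (0 : ℝ)..T, lam * (Real.exp (k t) - 1))) :
    ∃ Q : ℝ, x.x₂ T = μ * Real.exp κ * Q ∧ x.x₃ T = 2 * (ν * Real.exp (2 * κ) * Q) := by
  refine ⟨∫ t in (0 : ℝ)..T, x.x₁ t * Real.exp (-k t), ?_⟩
  -- As `κ ≥ 0`, emitting more than `B` only raises the dual bound; this treats `{B}` and `[B, ∞)`
  -- together.
  have hB := mul_le_mul_of_nonneg_left (hS _ hx.emission_mem) hκ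
  have key : ∀ δ₂ δ₃ : ℝ, _ := fun δ₂ δ₃ =>
    (ENNReal.ofReal_le_ofReal_iff hpos).1
      ((ofReal_integral_pathBracket_le hT hx h.continuousOn (κ + δ₂) (κ + δ₃)).trans hle)
  simp only [h.integral_pathBracket hT hx] at key
  constructor
  · rw [← one_mul (μ * Real.exp κ * _)]
    refine eq_of_forall_mul_le_exp_sub_one fun δ => ?_
    have := key δ 0
    simp only [mul_zero, Real.exp_zero, sub_self, zero_mul] at this
    rw [one_mul]
    linarith
  · refine eq_of_forall_mul_le_exp_sub_one fun δ => ?_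
    have := key 0 δ
    simp only [Real.exp_zero, sub_self, zero_mul] at this
    linarith

theorem IsCostate.ofReal_le_emissionRate {lam μ ν T κ u B : ℝ} {k : ℝ → ℝ}
    (h : IsCostate lam μ ν T κ k) (hT : 0 < T) (hκ : 0 ≤ κ) {S : Set ℝ} {x : EmissionPath}
    (hx : IsAdmissiblePath T u S x) (hS : ∀ b ∈ S, B ≤ b) :
    ENNReal.ofReal (κ * B - k 0 * u - ∫ t in (0 : ℝ)..T, lam * (Real.exp (k t) - 1))
      ≤ emissionRate lam μ ν T x := by
  have hB := mul_le_mul_of_nonneg_left (hS _ hx.emission_mem) hκ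
  have h1 := ofReal_integral_pathBracket_le (lam := lam) (μ := μ) (ν := ν) hT hx h.continuousOn
    (κ + 0) (κ + 0)
  rw [h.integral_pathBracket hT hx 0 0] at h1
  refine (ENNReal.ofReal_le_ofReal ?_).trans h1
  simp only [mul_zero, Real.exp_zero, sub_self, zero_mul]
  linarith

/-- A path that follows the Hamiltonian flow: its velocity is the gradient of the Hamiltonian at
the costate. -/
structure IsExtremal (lam μ ν T κ : ℝ) (k : ℝ → ℝ) (x : EmissionPath) : Prop where
  mem : ∀ t ∈ Icc 0 T, x.x₁ t ∈ Icc (0 : ℝ) 1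
  deriv₁ : ∀ t ∈ Icc 0 T, derivWithin x.x₁ (Icc 0 T) t = lam * (1 - x.x₁ t) * Real.exp (k t)
    - μ * x.x₁ t * Real.exp (-k t + κ) - ν * x.x₁ t * Real.exp (-k t + 2 * κ)
  deriv₂ : ∀ t ∈ Icc 0 T, derivWithin x.x₂ (Icc 0 T) t = μ * x.x₁ t * Real.exp (-k t + κ)
  deriv₃ : ∀ t ∈ Icc 0 T,
    derivWithin x.x₃ (Icc 0 T) t = 2 * (ν * x.x₁ t * Real.exp (-k t + 2 * κ))

/-- The costate maximises the bracket, which vanishes at zero dual variables. -/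
theorem IsExtremal.pathBracket_nonneg {lam μ ν T κ : ℝ} (hlam : 0 ≤ lam) (hμ : 0 ≤ μ)
    (hν : 0 ≤ ν) {k : ℝ → ℝ} {x : EmissionPath} (h : IsExtremal lam μ ν T κ k x) {t : ℝ}
    (ht : t ∈ Icc 0 T) : 0 ≤ pathBracket lam μ ν T x k κ κ t := by
  rw [← bracket_zero lam μ ν (x.x₁ t) (derivWithin x.x₁ (Icc 0 T) t)
    (derivWithin x.x₂ (Icc 0 T) t) (derivWithin x.x₃ (Icc 0 T) t)]
  exact bracket_le_bracket_of_gradient hlam hμ hν (h.mem t ht).1 (h.mem t ht).2 (h.deriv₁ t ht)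
    (h.deriv₂ t ht) (h.deriv₃ t ht) 0 0 0

theorem IsExtremal.emissionRate_eq {lam μ ν T κ u : ℝ} (hlam : 0 ≤ lam) (hμ : 0 ≤ μ)
    (hν : 0 ≤ ν) (hT : 0 < T) {k : ℝ → ℝ} {x : EmissionPath} (h : IsExtremal lam μ ν T κ k x)
    (hk : ContinuousOn k (Icc 0 T)) {S : Set ℝ} (hx : IsAdmissiblePath T u S x) :
    emissionRate lam μ ν T x
      = ENNReal.ofReal (∫ t in (0 : ℝ)..T, pathBracket lam μ ν T x k κ κ t) := by
  have hi : IntegrableOn (pathBracket lam μ ν T x k κ κ) (Icc 0 T) :=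
    (continuousOn_pathBracket hT hx hk κ κ).integrableOn_compact isCompact_Icc
  rw [intervalIntegral.integral_of_le hT.le, ← integral_Icc_eq_integral_Ioc,
    ofReal_integral_eq_lintegral_ofReal hi ((ae_restrict_iff' measurableSet_Icc).2
      (ae_of_all _ fun t ht => h.pathBracket_nonneg hlam hμ hν ht))]
  exact setLIntegral_congr_fun measurableSet_Icc fun t ht =>
    emissionLagrangian_eq_of_gradient hlam hμ hν (h.mem t ht).1 (h.mem t ht).2 (h.deriv₁ t ht)
      (h.deriv₂ t ht) (h.deriv₃ t ht)

/-- The dual value of an extremal is nonnegative. -/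
theorem IsExtremal.dualValue_nonneg {lam μ ν T κ u : ℝ} (hlam : 0 ≤ lam) (hμ : 0 ≤ μ)
    (hν : 0 ≤ ν) (hT : 0 < T) {k : ℝ → ℝ} {x : EmissionPath} (h : IsExtremal lam μ ν T κ k x)
    (hk : IsCostate lam μ ν T κ k) {S : Set ℝ} (hx : IsAdmissiblePath T u S x) :
    0 ≤ κ * (x.x₂ T + x.x₃ T) - k 0 * u - ∫ t in (0 : ℝ)..T, lam * (Real.exp (k t) - 1) := by
  have h0 := hk.integral_pathBracket hT hx 0 0
  simp only [mul_zero, Real.exp_zero, sub_self, zero_mul, add_zero] at h0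
  rw [← h0]
  exact intervalIntegral.integral_nonneg hT.le fun t ht => h.pathBracket_nonneg hlam hμ hν ht

/-- There is no duality gap along an extremal: the supremum in the local rate is attained at the
costate at every time. -/
theorem IsExtremal.emissionRate_eq_dualValue {lam μ ν T κ u : ℝ} (hlam : 0 ≤ lam) (hμ : 0 ≤ μ)
    (hν : 0 ≤ ν) (hT : 0 < T) {k : ℝ → ℝ} {x : EmissionPath} (h : IsExtremal lam μ ν T κ k x)
    (hk : IsCostate lam μ ν T κ k) {S : Set ℝ} (hx : IsAdmissiblePath T u S x) :
    emissionRate lam μ ν T x = ENNReal.ofReal (κ * (x.x₂ T + x.x₃ T) - k 0 * u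
      - ∫ t in (0 : ℝ)..T, lam * (Real.exp (k t) - 1)) := by
  have h0 := hk.integral_pathBracket hT hx 0 0
  simp only [mul_zero, Real.exp_zero, sub_self, zero_mul, add_zero] at h0
  rw [h.emissionRate_eq hlam hμ hν hT hk.continuousOn hx, h0]

/-- Verification: an admissible extremal with total emission `B` is optimal, and all optimal paths
emit in the same proportions. -/
theorem IsExtremal.optimal {lam μ ν T κ u B : ℝ} (hlam : 0 ≤ lam) (hμ : 0 ≤ μ)
    (hν : 0 ≤ ν) (hT : 0 < T) (hκ : 0 ≤ κ) {k : ℝ → ℝ} {x : EmissionPath}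
    (h : IsExtremal lam μ ν T κ k x) (hk : IsCostate lam μ ν T κ k) {S : Set ℝ}
    (hx : IsAdmissiblePath T u S x) (hB : x.x₂ T + x.x₃ T = B) (hS : ∀ b ∈ S, B ≤ b) :
    IsOptimalPath lam μ ν T u S x ∧ ∀ y, IsOptimalPath lam μ ν T u S y →
      ∃ Q : ℝ, y.x₂ T = μ * Real.exp κ * Q ∧ y.x₃ T = 2 * (ν * Real.exp (2 * κ) * Q) := by
  have h1 := h.emissionRate_eq_dualValue hlam hμ hν hT hk hx
  have h2 := h.dualValue_nonneg hlam hμ hν hT hk hx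
  rw [hB] at h1 h2
  refine ⟨⟨hx, fun y hy => h1.trans_le (hk.ofReal_le_emissionRate hT hκ hy hS)⟩, fun y hy => ?_⟩
  exact hk.emissions_of_emissionRate_le hT hκ hy.1 hS h2 ((hy.2 x hx).trans_eq h1)

/-! ### The flow of the matrix `!![d, l; M, -d]`, whose square is `w ^ 2 = d ^ 2 + l * M` -/

/-- `sinh (w t) / w`. -/
noncomputable def sn (w t : ℝ) : ℝ := Real.sinh (w * t) / w

/-- `cosh (w t)`. -/
noncomputable def cn (w t : ℝ) : ℝ := Real.cosh (w * t)

theorem sn_zero (w : ℝ) : sn w 0 = 0 := by simp [sn]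

theorem cn_zero (w : ℝ) : cn w 0 = 1 := by simp [cn]

theorem hasDerivAt_sn {w : ℝ} (hw : w ≠ 0) (t : ℝ) : HasDerivAt (sn w) (cn w t) t := by
  have h1 : HasDerivAt (fun t : ℝ => w * t) w t := by
    simpa using (hasDerivAt_id t).const_mul w
  refine (h1.sinh.div_const w).congr_deriv ?_
  rw [cn]; field_simp

theorem hasDerivAt_cn {w : ℝ} (hw : w ≠ 0) (t : ℝ) :
    HasDerivAt (cn w) (w ^ 2 * sn w t) t := by
  have h1 : HasDerivAt (fun t : ℝ => w * t) w t := by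
    simpa using (hasDerivAt_id t).const_mul w
  refine h1.cosh.congr_deriv ?_
  rw [sn]; field_simp

theorem sn_nonneg {w t : ℝ} (hw : 0 < w) (ht : 0 ≤ t) : 0 ≤ sn w t :=
  div_nonneg (Real.sinh_nonneg_iff.2 (mul_nonneg hw.le ht)) hw.le

theorem cn_pos (w t : ℝ) : 0 < cn w t := Real.cosh_pos _

/-- Here `w * sn w t = sinh (w t) < cosh (w t)`. Used for `d` and `-d`, this keeps the diagonal
entries of the flow positive. -/
theorem mul_sn_lt_cn {w t d : ℝ} (hw : 0 < w) (ht : 0 ≤ t) (hd : d ≤ w) :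
    d * sn w t < cn w t := by
  have h1 : w * sn w t = Real.sinh (w * t) := by rw [sn]; field_simp
  have h2 := Real.sinh_lt_cosh (w * t)
  have h3 := mul_le_mul_of_nonneg_right hd (sn_nonneg hw ht)
  rw [cn]; linarith

/-- The flow applied to `(1, 1)`: first component. -/
noncomputable def groundWeight (l d w s : ℝ) : ℝ := cn w s + sn w s * (d + l)

/-- The flow applied to `(1, 1)`: second component. -/
noncomputable def excitedWeight (d M w s : ℝ) : ℝ := cn w s + sn w s * (M - d)

/-- The row vector `(a, b)` transported by the flow: first component. -/
noncomputable def groundMass (d M w a b t : ℝ) : ℝ :=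
  a * (cn w t + d * sn w t) + b * (M * sn w t)

/-- The row vector `(a, b)` transported by the flow: second component. -/
noncomputable def excitedMass (l d w a b t : ℝ) : ℝ :=
  a * (l * sn w t) + b * (cn w t - d * sn w t)

section

variable {l d M w : ℝ}

theorem hasDerivAt_groundWeight (hw : w ≠ 0) (hw2 : w ^ 2 = d ^ 2 + l * M) (s : ℝ) :
    HasDerivAt (groundWeight l d w)
      (d * groundWeight l d w s + l * excitedWeight d M w s) s := by
  refine ((hasDerivAt_cn hw s).add ((hasDerivAt_sn hw s).mul_const (d + l))).congr_deriv ?_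
  rw [groundWeight, excitedWeight, hw2]; ring

theorem hasDerivAt_excitedWeight (hw : w ≠ 0) (hw2 : w ^ 2 = d ^ 2 + l * M) (s : ℝ) :
    HasDerivAt (excitedWeight d M w)
      (M * groundWeight l d w s - d * excitedWeight d M w s) s := by
  refine ((hasDerivAt_cn hw s).add ((hasDerivAt_sn hw s).mul_const (M - d))).congr_deriv ?_
  rw [groundWeight, excitedWeight, hw2]; ring

theorem hasDerivAt_groundMass (hw : w ≠ 0) (hw2 : w ^ 2 = d ^ 2 + l * M) (a b t : ℝ) :
    HasDerivAt (groundMass d M w a b)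
      (d * groundMass d M w a b t + M * excitedMass l d w a b t) t := by
  refine ((((hasDerivAt_cn hw t).add ((hasDerivAt_sn hw t).const_mul d)).const_mul a).add
    (((hasDerivAt_sn hw t).const_mul M).const_mul b)).congr_deriv ?_
  rw [groundMass, excitedMass, hw2]; ring

theorem hasDerivAt_excitedMass (hw : w ≠ 0) (hw2 : w ^ 2 = d ^ 2 + l * M) (a b t : ℝ) :
    HasDerivAt (excitedMass l d w a b)
      (l * groundMass d M w a b t - d * excitedMass l d w a b t) t := by
  refine ((((hasDerivAt_sn hw t).const_mul l).const_mul a).add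
    (((hasDerivAt_cn hw t).sub ((hasDerivAt_sn hw t).const_mul d)).const_mul b)).congr_deriv ?_
  rw [groundMass, excitedMass, hw2]; ring

theorem groundWeight_pos (hw : 0 < w) (hl : 0 ≤ l + d) {s : ℝ} (hs : 0 ≤ s) :
    0 < groundWeight l d w s := by
  have h1 := mul_nonneg (sn_nonneg hw hs) hl
  have h2 := cn_pos w s
  rw [groundWeight]; linarith

theorem excitedWeight_pos (hw : 0 < w) (hM : 0 ≤ M) (hd : |d| ≤ w) {s : ℝ} (hs : 0 ≤ s) :
    0 < excitedWeight d M w s := by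
  have h1 := mul_nonneg (sn_nonneg hw hs) hM
  have h2 := mul_sn_lt_cn hw hs (le_of_abs_le hd)
  rw [excitedWeight]; linarith

theorem groundMass_nonneg (hw : 0 < w) (hM : 0 ≤ M) (hd : |d| ≤ w) {a b t : ℝ} (ha : 0 ≤ a)
    (hb : 0 ≤ b) (ht : 0 ≤ t) : 0 ≤ groundMass d M w a b t := by
  have h2 := mul_sn_lt_cn hw ht ((neg_le_abs d).trans hd)
  have h1 := sn_nonneg hw ht
  rw [groundMass]
  exact add_nonneg (mul_nonneg ha (by linarith)) (mul_nonneg hb (mul_nonneg hM h1))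

theorem excitedMass_nonneg (hw : 0 < w) (hl : 0 ≤ l) (hd : |d| ≤ w) {a b t : ℝ} (ha : 0 ≤ a)
    (hb : 0 ≤ b) (ht : 0 ≤ t) : 0 ≤ excitedMass l d w a b t := by
  have h2 := mul_sn_lt_cn hw ht ((le_abs_self d).trans hd)
  have h1 := sn_nonneg hw ht
  rw [excitedMass]
  exact add_nonneg (mul_nonneg ha (mul_nonneg hl h1)) (mul_nonneg hb (by linarith))

/-- The pairing of the two transported vectors is conserved. -/
theorem mass_mul_weight (hw : w ≠ 0) (hw2 : w ^ 2 = d ^ 2 + l * M) (a b T t : ℝ) :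
    groundMass d M w a b t * groundWeight l d w (T - t)
      + excitedMass l d w a b t * excitedWeight d M w (T - t)
      = a * groundWeight l d w T + b * excitedWeight d M w T := by
  have hs : ∀ r : ℝ, HasDerivAt (fun r => T - r) (-1) r := fun r =>
    (hasDerivAt_id r).const_sub T
  have hder : ∀ r : ℝ, HasDerivAt (fun r => groundMass d M w a b r
      * groundWeight l d w (T - r)
      + excitedMass l d w a b r * excitedWeight d M w (T - r)) 0 r := fun r => by
    have := ((hasDerivAt_groundMass hw hw2 a b r).mul
      ((hasDerivAt_groundWeight hw hw2 (T - r)).comp r (hs r))).add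
      ((hasDerivAt_excitedMass hw hw2 a b r).mul
        ((hasDerivAt_excitedWeight hw hw2 (T - r)).comp r (hs r)))
    refine this.congr_deriv ?_
    simp only [Function.comp]
    ring
  have := is_const_of_deriv_eq_zero (fun r => (hder r).differentiableAt)
    (fun r => (hder r).deriv) t 0
  simp only [sub_zero] at this
  rw [this]
  simp [groundMass, excitedMass, sn_zero, cn_zero]

end

/-! ### The extremal with multiplier `κ` -/

/-- The total rate `μ e ^ κ + ν e ^ (2 κ)` of the tilted emissions. -/
noncomputable def tiltedRate (μ ν κ : ℝ) : ℝ := μ * Real.exp κ + ν * Real.exp (2 * κ)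

/-- Half the difference of the total decay rate and the excitation rate. -/
noncomputable def drift (lam μ ν : ℝ) : ℝ := (μ + ν - lam) / 2

/-- The positive eigenvalue of the tilted two-state flow. -/
noncomputable def growth (lam μ ν κ : ℝ) : ℝ :=
  Real.sqrt (drift lam μ ν ^ 2 + lam * tiltedRate μ ν κ)

/-- Exponential of the value function of a ground state atom, at time `s` before the end. -/
noncomputable def h₀ (lam μ ν κ s : ℝ) : ℝ :=
  groundWeight lam (drift lam μ ν) (growth lam μ ν κ) s

/-- Exponential of the value function of an excited atom, at time `s` before the end. -/
noncomputable def h₁ (lam μ ν κ s : ℝ) : ℝ :=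
  excitedWeight (drift lam μ ν) (tiltedRate μ ν κ) (growth lam μ ν κ) s

/-- The transported mass of ground state atoms, normalised so that `p₀ h₀` is their fraction. -/
noncomputable def p₀ (lam μ ν T κ u t : ℝ) : ℝ :=
  groundMass (drift lam μ ν) (tiltedRate μ ν κ) (growth lam μ ν κ)
    ((1 - u) / h₀ lam μ ν κ T) (u / h₁ lam μ ν κ T) t

/-- The transported mass of excited atoms, normalised so that `p₁ h₁` is their fraction. -/
noncomputable def p₁ (lam μ ν T κ u t : ℝ) : ℝ :=
  excitedMass lam (drift lam μ ν) (growth lam μ ν κ)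
    ((1 - u) / h₀ lam μ ν κ T) (u / h₁ lam μ ν κ T) t

/-- The emission profile of the extremal. -/
noncomputable def profile (lam μ ν T κ u t : ℝ) : ℝ :=
  p₁ lam μ ν T κ u t * h₀ lam μ ν κ (T - t)

/-- The dual variable of `x₁` along the extremal. -/
noncomputable def costate (lam μ ν T κ t : ℝ) : ℝ :=
  Real.log (h₁ lam μ ν κ (T - t) / h₀ lam μ ν κ (T - t))

/-- The extremal with multiplier `κ` and initial fraction `u` of excited atoms. -/
noncomputable def extremal (lam μ ν T κ u : ℝ) : EmissionPath where
  x₁ t := p₁ lam μ ν T κ u t * h₁ lam μ ν κ (T - t)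
  x₂ t := μ * Real.exp κ * ∫ s in (0 : ℝ)..t, profile lam μ ν T κ u s
  x₃ t := 2 * (ν * Real.exp (2 * κ)) * ∫ s in (0 : ℝ)..t, profile lam μ ν T κ u s

section

variable {lam μ ν T : ℝ}

theorem tiltedRate_pos (hμ : 0 < μ) (hν : 0 < ν) (κ : ℝ) : 0 < tiltedRate μ ν κ := by
  unfold tiltedRate; positivity

theorem growth_sq (hlam : 0 < lam) (hμ : 0 < μ) (hν : 0 < ν) (κ : ℝ) :
    growth lam μ ν κ ^ 2 = drift lam μ ν ^ 2 + lam * tiltedRate μ ν κ := by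
  have := tiltedRate_pos hμ hν κ
  exact Real.sq_sqrt (by positivity)

theorem growth_pos (hlam : 0 < lam) (hμ : 0 < μ) (hν : 0 < ν) (κ : ℝ) :
    0 < growth lam μ ν κ := by
  have := tiltedRate_pos hμ hν κ
  exact Real.sqrt_pos.2 (by positivity)

theorem abs_drift_le_growth (hlam : 0 < lam) (hμ : 0 < μ) (hν : 0 < ν) (κ : ℝ) :
    |drift lam μ ν| ≤ growth lam μ ν κ := by
  have := tiltedRate_pos hμ hν κ
  exact Real.abs_le_sqrt (le_add_of_nonneg_right (by positivity))

theorem h₀_pos (hlam : 0 < lam) (hμ : 0 < μ) (hν : 0 < ν) (κ : ℝ) {s : ℝ} (hs : 0 ≤ s) :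
    0 < h₀ lam μ ν κ s :=
  groundWeight_pos (growth_pos hlam hμ hν κ) (by unfold drift; linarith) hs

theorem h₁_pos (hlam : 0 < lam) (hμ : 0 < μ) (hν : 0 < ν) (κ : ℝ) {s : ℝ} (hs : 0 ≤ s) :
    0 < h₁ lam μ ν κ s :=
  excitedWeight_pos (growth_pos hlam hμ hν κ) (tiltedRate_pos hμ hν κ).le
    (abs_drift_le_growth hlam hμ hν κ) hs

theorem p₀_nonneg (hlam : 0 < lam) (hμ : 0 < μ) (hν : 0 < ν) (hT : 0 < T) (κ : ℝ) {u t : ℝ}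
    (hu : u ∈ Icc (0 : ℝ) 1) (ht : 0 ≤ t) : 0 ≤ p₀ lam μ ν T κ u t :=
  groundMass_nonneg (growth_pos hlam hμ hν κ) (tiltedRate_pos hμ hν κ).le
    (abs_drift_le_growth hlam hμ hν κ)
    (div_nonneg (sub_nonneg.2 hu.2) (h₀_pos hlam hμ hν κ hT.le).le)
    (div_nonneg hu.1 (h₁_pos hlam hμ hν κ hT.le).le) ht

theorem p₁_nonneg (hlam : 0 < lam) (hμ : 0 < μ) (hν : 0 < ν) (hT : 0 < T) (κ : ℝ) {u t : ℝ}
    (hu : u ∈ Icc (0 : ℝ) 1) (ht : 0 ≤ t) : 0 ≤ p₁ lam μ ν T κ u t :=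
  excitedMass_nonneg (growth_pos hlam hμ hν κ) hlam.le
    (abs_drift_le_growth hlam hμ hν κ)
    (div_nonneg (sub_nonneg.2 hu.2) (h₀_pos hlam hμ hν κ hT.le).le)
    (div_nonneg hu.1 (h₁_pos hlam hμ hν κ hT.le).le) ht

/-- The conserved pairing equals `(1 - u) + u` by the normalisation of `p`. Hence `p₀ h₀ = 1 - x₁`,
which gives `x₁ ≤ 1`. -/
theorem p₀_mul_h₀_add (hlam : 0 < lam) (hμ : 0 < μ) (hν : 0 < ν) (hT : 0 < T) (κ u t : ℝ) :
    p₀ lam μ ν T κ u t * h₀ lam μ ν κ (T - t) + p₁ lam μ ν T κ u t * h₁ lam μ ν κ (T - t)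
      = 1 := by
  have h := mass_mul_weight (growth_pos hlam hμ hν κ).ne' (growth_sq hlam hμ hν κ)
    ((1 - u) / h₀ lam μ ν κ T) (u / h₁ lam μ ν κ T) T t
  refine h.trans ?_
  change (1 - u) / h₀ lam μ ν κ T * h₀ lam μ ν κ T + u / h₁ lam μ ν κ T * h₁ lam μ ν κ T = 1
  rw [div_mul_cancel₀ _ (h₀_pos hlam hμ hν κ hT.le).ne',
    div_mul_cancel₀ _ (h₁_pos hlam hμ hν κ hT.le).ne']
  ring

theorem exp_costate (hlam : 0 < lam) (hμ : 0 < μ) (hν : 0 < ν) (κ : ℝ) {t : ℝ} (ht : t ≤ T) :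
    Real.exp (costate lam μ ν T κ t) = h₁ lam μ ν κ (T - t) / h₀ lam μ ν κ (T - t) :=
  Real.exp_log (div_pos (h₁_pos hlam hμ hν κ (sub_nonneg.2 ht))
    (h₀_pos hlam hμ hν κ (sub_nonneg.2 ht)))

theorem exp_neg_costate (hlam : 0 < lam) (hμ : 0 < μ) (hν : 0 < ν) (κ : ℝ) {t : ℝ}
    (ht : t ≤ T) :
    Real.exp (-costate lam μ ν T κ t) = h₀ lam μ ν κ (T - t) / h₁ lam μ ν κ (T - t) := by
  rw [Real.exp_neg, exp_costate hlam hμ hν κ ht, inv_div]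

theorem hasDerivAt_h₀ (hlam : 0 < lam) (hμ : 0 < μ) (hν : 0 < ν) (κ T t : ℝ) :
    HasDerivAt (fun t => h₀ lam μ ν κ (T - t))
      (-(drift lam μ ν * h₀ lam μ ν κ (T - t) + lam * h₁ lam μ ν κ (T - t))) t := by
  have := (hasDerivAt_groundWeight (growth_pos hlam hμ hν κ).ne' (growth_sq hlam hμ hν κ)
    (T - t)).comp t ((hasDerivAt_id t).const_sub T)
  exact this.congr_deriv (mul_neg_one _)

theorem hasDerivAt_h₁ (hlam : 0 < lam) (hμ : 0 < μ) (hν : 0 < ν) (κ T t : ℝ) :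
    HasDerivAt (fun t => h₁ lam μ ν κ (T - t))
      (-(tiltedRate μ ν κ * h₀ lam μ ν κ (T - t) - drift lam μ ν * h₁ lam μ ν κ (T - t))) t := by
  have := (hasDerivAt_excitedWeight (growth_pos hlam hμ hν κ).ne' (growth_sq hlam hμ hν κ)
    (T - t)).comp t ((hasDerivAt_id t).const_sub T)
  exact this.congr_deriv (mul_neg_one _)

theorem hasDerivAt_p₁ (hlam : 0 < lam) (hμ : 0 < μ) (hν : 0 < ν) (κ u t : ℝ) :
    HasDerivAt (p₁ lam μ ν T κ u)
      (lam * p₀ lam μ ν T κ u t - drift lam μ ν * p₁ lam μ ν T κ u t) t :=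
  hasDerivAt_excitedMass (growth_pos hlam hμ hν κ).ne' (growth_sq hlam hμ hν κ) _ _ t

/-- The backward equations have diagonal entries `-lam` and `-(μ + ν)`; adding half of `lam + μ + ν`
makes them `drift` and `-drift`. This multiplies `h₀` and `h₁` by a common exponential, which
cancels in the quotient, so its logarithm solves the costate equation. -/
theorem isCostate_costate (hlam : 0 < lam) (hμ : 0 < μ) (hν : 0 < ν) (κ : ℝ) :
    IsCostate lam μ ν T κ (costate lam μ ν T κ) where
  hasDerivAt t ht := by
    have a₀ := h₀_pos hlam hμ hν κ (sub_nonneg.2 ht.2)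
    have a₁ := h₁_pos hlam hμ hν κ (sub_nonneg.2 ht.2)
    have := ((hasDerivAt_h₁ hlam hμ hν κ T t).div (hasDerivAt_h₀ hlam hμ hν κ T t) a₀.ne').log
      (div_pos a₁ a₀).ne'
    refine this.congr_deriv ?_
    rw [Real.exp_add, Real.exp_add, exp_costate hlam hμ hν κ ht.2,
      exp_neg_costate hlam hμ hν κ ht.2]
    simp only [Pi.div_apply]
    field_simp
    simp only [drift, tiltedRate]
    ring
  terminal := by
    simp [costate, h₀, h₁, groundWeight, excitedWeight, sn_zero, cn_zero]

theorem continuous_profile (hlam : 0 < lam) (hμ : 0 < μ) (hν : 0 < ν) (κ u : ℝ) :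
    Continuous (profile lam μ ν T κ u) :=
  continuous_iff_continuousAt.2 fun t =>
    ((hasDerivAt_p₁ hlam hμ hν κ u t).mul (hasDerivAt_h₀ hlam hμ hν κ T t)).continuousAt

theorem hasDerivAt_const_mul_integral_profile (hlam : 0 < lam) (hμ : 0 < μ) (hν : 0 < ν)
    (c κ u t : ℝ) :
    HasDerivAt (fun t => c * ∫ s in (0 : ℝ)..t, profile lam μ ν T κ u s)
      (c * profile lam μ ν T κ u t) t :=
  (((continuous_profile hlam hμ hν κ u).integral_hasStrictDerivAt 0 t).hasDerivAt).const_mul c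

theorem hasDerivAt_extremal_x₁ (hlam : 0 < lam) (hμ : 0 < μ) (hν : 0 < ν) (κ u t : ℝ) :
    HasDerivAt (extremal lam μ ν T κ u).x₁
      (lam * (p₀ lam μ ν T κ u t * h₁ lam μ ν κ (T - t))
        - tiltedRate μ ν κ * profile lam μ ν T κ u t) t := by
  refine ((hasDerivAt_p₁ hlam hμ hν κ u t).mul (hasDerivAt_h₁ hlam hμ hν κ T t)).congr_deriv ?_
  rw [profile]; ring

theorem derivWithin_of_hasDerivAt {f : ℝ → ℝ} {f' t : ℝ} (hT : 0 < T) (h : HasDerivAt f f' t)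
    (ht : t ∈ Icc 0 T) : derivWithin f (Icc 0 T) t = f' :=
  h.hasDerivWithinAt.derivWithin (uniqueDiffOn_Icc hT t ht)

theorem isExtremal_extremal (hlam : 0 < lam) (hμ : 0 < μ) (hν : 0 < ν) (hT : 0 < T) (κ : ℝ)
    {u : ℝ} (hu : u ∈ Icc (0 : ℝ) 1) :
    IsExtremal lam μ ν T κ (costate lam μ ν T κ) (extremal lam μ ν T κ u) := by
  -- `p₁ h₁ * (h₀ / h₁) = p₁ h₀`: the profile is the common time factor of both emission rates.
  have hprof : ∀ t ∈ Icc 0 T, profile lam μ ν T κ u t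
      = (extremal lam μ ν T κ u).x₁ t * Real.exp (-costate lam μ ν T κ t) := fun t ht => by
    have a₁ := h₁_pos hlam hμ hν κ (sub_nonneg.2 ht.2)
    rw [exp_neg_costate hlam hμ hν κ ht.2]
    simp only [extremal, profile]
    field_simp
  have hsum : ∀ t, 1 - (extremal lam μ ν T κ u).x₁ t
      = p₀ lam μ ν T κ u t * h₀ lam μ ν κ (T - t) := fun t => by
    rw [← p₀_mul_h₀_add hlam hμ hν hT κ u t]; simp [extremal]
  refine ⟨fun t ht => ⟨?_, ?_⟩, fun t ht => ?_, fun t ht => ?_, fun t ht => ?_⟩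
  · exact mul_nonneg (p₁_nonneg hlam hμ hν hT κ hu ht.1)
      (h₁_pos hlam hμ hν κ (sub_nonneg.2 ht.2)).le
  · rw [← sub_nonneg, hsum]
    exact mul_nonneg (p₀_nonneg hlam hμ hν hT κ hu ht.1)
      (h₀_pos hlam hμ hν κ (sub_nonneg.2 ht.2)).le
  · rw [derivWithin_of_hasDerivAt hT (hasDerivAt_extremal_x₁ hlam hμ hν κ u t) ht, hsum,
      hprof t ht, Real.exp_add, Real.exp_add, exp_costate hlam hμ hν κ ht.2]
    have a₀ := h₀_pos hlam hμ hν κ (sub_nonneg.2 ht.2)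
    simp only [tiltedRate]
    field_simp
    ring
  · refine (derivWithin_of_hasDerivAt hT
      (hasDerivAt_const_mul_integral_profile hlam hμ hν (μ * Real.exp κ) κ u t) ht).trans ?_
    rw [hprof t ht, Real.exp_add]
    ring
  · refine (derivWithin_of_hasDerivAt hT
      (hasDerivAt_const_mul_integral_profile hlam hμ hν (2 * (ν * Real.exp (2 * κ))) κ u t) ht).trans ?_
    rw [hprof t ht, Real.exp_add]
    ring

theorem contDiffOn_const_mul_integral_profile (hlam : 0 < lam) (hμ : 0 < μ) (hν : 0 < ν)
    (c κ u : ℝ) (s : Set ℝ) :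
    ContDiffOn ℝ 1 (fun t => c * ∫ s in (0 : ℝ)..t, profile lam μ ν T κ u s) s := by
  refine (contDiff_one_iff_deriv.2 ⟨fun t => ?_, ?_⟩).contDiffOn
  · exact (hasDerivAt_const_mul_integral_profile hlam hμ hν c κ u t).differentiableAt
  · have hd : deriv (fun t => c * ∫ s in (0 : ℝ)..t, profile lam μ ν T κ u s)
        = fun t => c * profile lam μ ν T κ u t :=
      funext fun t => (hasDerivAt_const_mul_integral_profile hlam hμ hν c κ u t).deriv
    rw [hd]
    exact (continuous_profile hlam hμ hν κ u).const_mul c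

theorem profile_nonneg (hlam : 0 < lam) (hμ : 0 < μ) (hν : 0 < ν) (hT : 0 < T) (κ : ℝ)
    {u t : ℝ} (hu : u ∈ Icc (0 : ℝ) 1) (ht : t ∈ Icc 0 T) : 0 ≤ profile lam μ ν T κ u t :=
  mul_nonneg (p₁_nonneg hlam hμ hν hT κ hu ht.1) (h₀_pos hlam hμ hν κ (sub_nonneg.2 ht.2)).le

theorem isAdmissiblePath_extremal (hlam : 0 < lam) (hμ : 0 < μ) (hν : 0 < ν) (hT : 0 < T)
    (κ : ℝ) {u : ℝ} (hu : u ∈ Icc (0 : ℝ) 1) {S : Set ℝ}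
    (hS : (extremal lam μ ν T κ u).x₂ T + (extremal lam μ ν T κ u).x₃ T ∈ S) :
    IsAdmissiblePath T u S (extremal lam μ ν T κ u) where
  contDiffOn₁ := by
    have hw := (growth_pos hlam hμ hν κ).ne'
    have : ContDiff ℝ 1 (extremal lam μ ν T κ u).x₁ := by
      simp only [extremal, p₁, h₁, excitedMass, excitedWeight, cn, sn]
      fun_prop
    exact this.contDiffOn
  contDiffOn₂ := contDiffOn_const_mul_integral_profile hlam hμ hν _ κ u _
  contDiffOn₃ := contDiffOn_const_mul_integral_profile hlam hμ hν _ κ u _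
  nonneg t ht := by
    have hi : 0 ≤ ∫ s in (0 : ℝ)..t, profile lam μ ν T κ u s :=
      intervalIntegral.integral_nonneg ht.1 fun s hs =>
        profile_nonneg hlam hμ hν hT κ hu ⟨hs.1, hs.2.trans ht.2⟩
    exact ⟨((isExtremal_extremal hlam hμ hν hT κ hu).mem t ht).1,
      mul_nonneg (by positivity) hi, mul_nonneg (by positivity) hi⟩
  init₁ := by
    simp only [extremal, p₁, excitedMass, sn_zero, cn_zero, sub_zero, mul_zero, zero_add, mul_one]
    exact div_mul_cancel₀ _ (h₁_pos hlam hμ hν κ hT.le).ne'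
  init₂ := by simp [extremal]
  init₃ := by simp [extremal]
  emission_mem := hS

end

/-! ### The total emission as a function of the multiplier -/

/-- The total emission of the extremal. -/
noncomputable def totalEmission (lam μ ν T κ u : ℝ) : ℝ :=
  (extremal lam μ ν T κ u).x₂ T + (extremal lam μ ν T κ u).x₃ T

section

variable {lam μ ν T : ℝ}

@[fun_prop]
theorem continuous_growth (lam μ ν : ℝ) : Continuous (growth lam μ ν) := by
  unfold growth tiltedRate
  fun_prop

/-- Continuity in `κ` serves the intermediate value theorem, continuity in `u` the uniform bound
over `[0, 1]`. -/
theorem continuous_totalEmission (hlam : 0 < lam) (hμ : 0 < μ) (hν : 0 < ν) (hT : 0 < T) :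
    Continuous fun q : ℝ × ℝ => totalEmission lam μ ν T q.1 q.2 := by
  have hw : ∀ κ, growth lam μ ν κ ≠ 0 := fun κ => (growth_pos hlam hμ hν κ).ne'
  have hM : Continuous (tiltedRate μ ν) := by unfold tiltedRate; fun_prop
  have hsn : Continuous fun r : ℝ × ℝ => sn (growth lam μ ν r.1) r.2 :=
    Continuous.div (by fun_prop) (by fun_prop) fun r => hw r.1
  have hcn : Continuous fun r : ℝ × ℝ => cn (growth lam μ ν r.1) r.2 := by
    unfold cn; fun_prop
  have hh₀ : Continuous fun r : ℝ × ℝ => h₀ lam μ ν r.1 r.2 :=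
    hcn.add (hsn.mul continuous_const)
  have hh₁ : Continuous fun r : ℝ × ℝ => h₁ lam μ ν r.1 r.2 :=
    hcn.add (hsn.mul ((hM.comp continuous_fst).sub continuous_const))
  have ha : Continuous fun q : ℝ × ℝ => (1 - q.2) / h₀ lam μ ν q.1 T :=
    (continuous_const.sub continuous_snd).div
      (hh₀.comp (continuous_fst.prodMk continuous_const))
      fun q => (h₀_pos hlam hμ hν q.1 hT.le).ne'
  have hb : Continuous fun q : ℝ × ℝ => q.2 / h₁ lam μ ν q.1 T :=
    continuous_snd.div (hh₁.comp (continuous_fst.prodMk continuous_const))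
      fun q => (h₁_pos hlam hμ hν q.1 hT.le).ne'
  have hp : Continuous (Function.uncurry fun (q : ℝ × ℝ) (t : ℝ) =>
      profile lam μ ν T q.1 q.2 t) := by
    have m : Continuous fun r : (ℝ × ℝ) × ℝ => (r.1.1, r.2) := by fun_prop
    have m' : Continuous fun r : (ℝ × ℝ) × ℝ => (r.1.1, T - r.2) := by fun_prop
    have s' := hsn.comp m
    have c' := hcn.comp m
    exact (((ha.comp continuous_fst).mul (continuous_const.mul s')).add
      ((hb.comp continuous_fst).mul (c'.sub (continuous_const.mul s')))).mul (hh₀.comp m')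
  have hi := intervalIntegral.continuous_parametric_intervalIntegral_of_continuous' (μ := volume)
    hp 0 T
  unfold totalEmission extremal
  fun_prop

/-! ### Growth of the total emission as the multiplier tends to infinity -/

theorem cosh_le_two_mul_sinh {x : ℝ} (hx : 1 ≤ x) : Real.cosh x ≤ 2 * Real.sinh x := by
  have h1 := Real.add_one_le_exp x
  have h2 : Real.exp x * Real.exp (-x) = 1 := by rw [← Real.exp_add]; simp
  have h3 := Real.exp_pos (-x)
  rw [Real.cosh_eq, Real.sinh_eq]
  nlinarith

theorem tiltedRate_ge (hμ : 0 < μ) (hν : 0 < ν) {κ : ℝ} (hκ : 0 ≤ κ) :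
    μ + ν ≤ tiltedRate μ ν κ := by
  have h1 := Real.one_le_exp hκ
  have h2 := Real.one_le_exp (mul_nonneg zero_le_two hκ)
  rw [tiltedRate]
  nlinarith

/-- The difference `h₁ - h₀` is `sn` times `tiltedRate - (μ + ν)`, which is nonnegative for `κ ≥ 0`.
-/
theorem one_le_exp_costate (hlam : 0 < lam) (hμ : 0 < μ) (hν : 0 < ν) {κ t : ℝ} (hκ : 0 ≤ κ)
    (ht : t ≤ T) : 1 ≤ Real.exp (costate lam μ ν T κ t) := by
  rw [exp_costate hlam hμ hν κ ht, one_le_div (h₀_pos hlam hμ hν κ (sub_nonneg.2 ht))]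
  refine add_le_add le_rfl (mul_le_mul_of_nonneg_left ?_
    (sn_nonneg (growth_pos hlam hμ hν κ) (sub_nonneg.2 ht)))
  have := tiltedRate_ge hμ hν hκ
  rw [drift]; linarith

/-- Away from the terminal time `cn ≤ 2 w sn`, so `sn` factors out of both bounds and cancels in `h₁
/ h₀`. -/
theorem div_le_exp_costate (hlam : 0 < lam) (hμ : 0 < μ) (hν : 0 < ν) {κ t : ℝ} (hκ : 0 ≤ κ)
    (ht : 1 ≤ growth lam μ ν κ * (T - t)) :
    (tiltedRate μ ν κ - drift lam μ ν) / (2 * growth lam μ ν κ + (drift lam μ ν + lam))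
      ≤ Real.exp (costate lam μ ν T κ t) := by
  have hw := growth_pos hlam hμ hν κ
  have hs : 0 < T - t := pos_of_mul_pos_right (zero_lt_one.trans_le ht) hw.le
  have hD : 0 < drift lam μ ν + lam := by rw [drift]; linarith
  have hsn := sn_nonneg hw hs.le
  have hc : cn (growth lam μ ν κ) (T - t)
      ≤ 2 * (growth lam μ ν κ * sn (growth lam μ ν κ) (T - t)) := by
    rw [sn, mul_div_cancel₀ _ hw.ne']
    exact cosh_le_two_mul_sinh ht
  have hM : 0 ≤ tiltedRate μ ν κ - drift lam μ ν := by
    have := tiltedRate_ge hμ hν hκ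
    rw [drift]; linarith
  rw [exp_costate hlam hμ hν κ (sub_pos.1 hs).le,
    div_le_div_iff₀ (by positivity) (h₀_pos hlam hμ hν κ hs.le)]
  have h1 : h₀ lam μ ν κ (T - t)
      ≤ sn (growth lam μ ν κ) (T - t) * (2 * growth lam μ ν κ + (drift lam μ ν + lam)) := by
    simp only [h₀, groundWeight]; linarith
  have h2 : sn (growth lam μ ν κ) (T - t) * (tiltedRate μ ν κ - drift lam μ ν)
      ≤ h₁ lam μ ν κ (T - t) := le_add_of_nonneg_left (cn_pos _ _).le
  calc _ ≤ (tiltedRate μ ν κ - drift lam μ ν)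
        * (sn (growth lam μ ν κ) (T - t) * (2 * growth lam μ ν κ + (drift lam μ ν + lam))) :=
        mul_le_mul_of_nonneg_left h1 hM
    _ = (sn (growth lam μ ν κ) (T - t) * (tiltedRate μ ν κ - drift lam μ ν))
        * (2 * growth lam μ ν κ + (drift lam μ ν + lam)) := by ring
    _ ≤ _ := mul_le_mul_of_nonneg_right h2 (by positivity)

/-- With the upper bound that follows, `growth` has order `e^κ` while `tiltedRate` has order
`e^(2κ)`; their quotient gives the linear growth of `e^k` in `e^κ`. -/
theorem growth_ge (hlam : 0 < lam) (hμ : 0 < μ) (hν : 0 < ν) (κ : ℝ) :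
    Real.sqrt (lam * ν) * Real.exp κ ≤ growth lam μ ν κ := by
  have hE : Real.exp (2 * κ) = Real.exp κ ^ 2 := by rw [← Real.exp_nat_mul]; norm_num
  refine Real.le_sqrt_of_sq_le ?_
  rw [mul_pow, Real.sq_sqrt (by positivity), tiltedRate, hE]
  have : 0 ≤ lam * (μ * Real.exp κ) := by positivity
  nlinarith [sq_nonneg (drift lam μ ν)]

theorem growth_le (hlam : 0 < lam) (hμ : 0 < μ) (hν : 0 < ν) {κ : ℝ} (hκ : 0 ≤ κ) :
    growth lam μ ν κ ≤ Real.sqrt (drift lam μ ν ^ 2 + lam * (μ + ν)) * Real.exp κ := by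
  have hE : Real.exp (2 * κ) = Real.exp κ ^ 2 := by rw [← Real.exp_nat_mul]; norm_num
  have h1 := Real.one_le_exp hκ
  have h2 : Real.exp κ ≤ Real.exp κ ^ 2 := by nlinarith
  refine Real.sqrt_le_iff.2 ⟨by positivity, ?_⟩
  rw [mul_pow, Real.sq_sqrt (by positivity), tiltedRate, hE]
  have h3 : drift lam μ ν ^ 2 ≤ drift lam μ ν ^ 2 * Real.exp κ ^ 2 :=
    le_mul_of_one_le_right (sq_nonneg _) (h1.trans h2)
  have h4 := mul_le_mul_of_nonneg_left h2 (mul_pos hlam hμ).le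
  linarith

/-- Far from the terminal time the exponential of the costate is at least linear in `e ^ κ`. -/
theorem exists_linear_le_exp_costate (hlam : 0 < lam) (hμ : 0 < μ) (hν : 0 < ν) (T : ℝ) :
    ∃ c > 0, ∃ c' : ℝ, 0 ≤ c' ∧ ∀ κ, 0 ≤ κ → ∀ t, 1 ≤ growth lam μ ν κ * (T - t) →
      c * Real.exp κ - c' ≤ Real.exp (costate lam μ ν T κ t) := by
  have hD : 0 < drift lam μ ν + lam := by rw [drift]; linarith
  set G := 2 * Real.sqrt (drift lam μ ν ^ 2 + lam * (μ + ν)) + (drift lam μ ν + lam) with hG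
  have hG0 : 0 < G := by positivity
  refine ⟨ν / G, by positivity, |drift lam μ ν| / G, by positivity, fun κ hκ t ht => ?_⟩
  refine le_trans ?_ (div_le_exp_costate hlam hμ hν hκ ht)
  have hE : Real.exp (2 * κ) = Real.exp κ * Real.exp κ := by rw [← Real.exp_add]; ring_nf
  have h1 := Real.one_le_exp hκ
  have hw := growth_pos hlam hμ hν κ
  have hle := growth_le hlam hμ hν hκ
  have hM : 0 ≤ tiltedRate μ ν κ - drift lam μ ν := by
    have := tiltedRate_ge hμ hν hκ
    rw [drift]; linarith
  have hden : 2 * growth lam μ ν κ + (drift lam μ ν + lam) ≤ G * Real.exp κ := by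
    rw [hG]; nlinarith
  refine le_trans ?_ (div_le_div_of_nonneg_left hM (by positivity) hden)
  rw [le_div_iff₀ (by positivity)]
  have e1 : (ν / G * Real.exp κ - |drift lam μ ν| / G) * (G * Real.exp κ)
      = ν * (Real.exp κ * Real.exp κ) - |drift lam μ ν| * Real.exp κ := by
    field_simp
  rw [e1, tiltedRate, hE]
  have h2 := le_abs_self (drift lam μ ν)
  have h3 : |drift lam μ ν| ≤ |drift lam μ ν| * Real.exp κ :=
    le_mul_of_one_le_right (abs_nonneg _) h1
  have h4 : 0 ≤ μ * Real.exp κ := by positivity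
  linarith

/-- Nonnegativity of the dual value bounds `κ` times the emission below by the integral of `lam (e^k
- 1)`, since `k 0 * u ≥ 0`. The second half of the time interval contributes a nonnegative amount
and is dropped. -/
theorem mul_totalEmission_ge (hlam : 0 < lam) (hμ : 0 < μ) (hν : 0 < ν) (hT : 0 < T) {κ u m : ℝ}
    (hκ : 0 ≤ κ) (hu : u ∈ Icc (0 : ℝ) 1)
    (hm : ∀ t ≤ T / 2, m ≤ Real.exp (costate lam μ ν T κ t)) :
    lam * (m - 1) * (T / 2) ≤ κ * totalEmission lam μ ν T κ u := by
  have hk := isCostate_costate (T := T) hlam hμ hν κ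
  have h1 := (isExtremal_extremal hlam hμ hν hT κ hu).dualValue_nonneg hlam.le hμ.le hν.le hT hk
    (isAdmissiblePath_extremal hlam hμ hν hT κ hu (S := univ) (mem_univ _))
  have h2 : 0 ≤ costate lam μ ν T κ 0 * u :=
    mul_nonneg (Real.one_le_exp_iff.1 (one_le_exp_costate hlam hμ hν hκ hT.le)) hu.1
  have hc := hk.continuousOn
  have hce : ContinuousOn (fun t => lam * (Real.exp (costate lam μ ν T κ t) - 1)) (Icc 0 T) := by
    fun_prop
  have hi₁ : IntervalIntegrable (fun t => lam * (Real.exp (costate lam μ ν T κ t) - 1)) volume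
      0 (T / 2) :=
    (hce.mono (Icc_subset_Icc_right (by linarith))).intervalIntegrable_of_Icc (by linarith)
  have hi₂ : IntervalIntegrable (fun t => lam * (Real.exp (costate lam μ ν T κ t) - 1)) volume
      (T / 2) T :=
    (hce.mono (Icc_subset_Icc_left (by linarith))).intervalIntegrable_of_Icc (by linarith)
  have h3 := intervalIntegral.integral_add_adjacent_intervals hi₁ hi₂
  have h4 : 0 ≤ ∫ t in (T / 2)..T, lam * (Real.exp (costate lam μ ν T κ t) - 1) :=
    intervalIntegral.integral_nonneg (by linarith) fun t ht =>
      mul_nonneg hlam.le (sub_nonneg.2 (one_le_exp_costate hlam hμ hν hκ ht.2))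
  have h5 : ∫ _ in (0 : ℝ)..(T / 2), lam * (m - 1)
      ≤ ∫ t in (0 : ℝ)..(T / 2), lam * (Real.exp (costate lam μ ν T κ t) - 1) :=
    intervalIntegral.integral_mono_on (by linarith) intervalIntegrable_const hi₁ fun t ht =>
      mul_le_mul_of_nonneg_left (sub_le_sub_right (hm t ht.2) 1) hlam.le
  rw [intervalIntegral.integral_const, smul_eq_mul, sub_zero] at h5
  rw [totalEmission]
  linarith

theorem eventually_le_totalEmission (hlam : 0 < lam) (hμ : 0 < μ) (hν : 0 < ν) (hT : 0 < T)
    (B : ℝ) : ∀ᶠ κ in atTop, ∀ u ∈ Icc (0 : ℝ) 1, B ≤ totalEmission lam μ ν T κ u := by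
  obtain ⟨c, hc, c', hc', hlin⟩ := exists_linear_le_exp_costate hlam hμ hν T
  have hsq : 0 < Real.sqrt (lam * ν) := Real.sqrt_pos.2 (by positivity)
  -- The threshold makes `lam (c e^κ - c' - 1) (T / 2) ≥ κ |B|` once `κ ≥ 1`; it does not involve
  -- `u`.
  have hd := (Real.tendsto_exp_div_pow_atTop 1).eventually_ge_atTop
    ((|B| + lam * (c' + 1) * (T / 2)) / (lam * c * (T / 2)))
  filter_upwards [hd, eventually_ge_atTop 1,
    Real.tendsto_exp_atTop.eventually_ge_atTop (1 / (Real.sqrt (lam * ν) * (T / 2)))]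
    with κ h1 hκ h2 u hu
  have hκ0 : 0 < κ := zero_lt_one.trans_le hκ
  have hm : ∀ t ≤ T / 2, c * Real.exp κ - c' ≤ Real.exp (costate lam μ ν T κ t) := by
    intro t ht
    refine hlin κ hκ0.le t ?_
    rw [div_le_iff₀ (by positivity)] at h2
    calc (1 : ℝ) ≤ (Real.sqrt (lam * ν) * Real.exp κ) * (T / 2) := by linarith
      _ ≤ growth lam μ ν κ * (T - t) := mul_le_mul (growth_ge hlam hμ hν κ) (by linarith)
        (by positivity) (growth_pos hlam hμ hν κ).le
  have h3 := mul_totalEmission_ge hlam hμ hν hT hκ0.le hu hm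
  rw [pow_one, div_le_div_iff₀ (by positivity) hκ0] at h1
  have h4 : lam * (c' + 1) * (T / 2) ≤ lam * (c' + 1) * (T / 2) * κ :=
    le_mul_of_one_le_right (by positivity) hκ
  have h5 : κ * |B| ≤ κ * totalEmission lam μ ν T κ u := by linarith
  exact (le_abs_self B).trans (le_of_mul_le_mul_left h5 hκ0)

theorem exists_totalEmission_bound (hlam : 0 < lam) (hμ : 0 < μ) (hν : 0 < ν) (hT : 0 < T)
    (κ : ℝ) : ∃ C, ∀ u ∈ Icc (0 : ℝ) 1, totalEmission lam μ ν T κ u ≤ C := by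
  have hc : Continuous fun u => totalEmission lam μ ν T κ u :=
    (continuous_totalEmission hlam hμ hν hT).comp (continuous_const.prodMk continuous_id)
  obtain ⟨C, hC⟩ := (isCompact_Icc (a := (0 : ℝ)) (b := 1)).bddAbove_image hc.continuousOn
  exact ⟨C, fun u hu => hC (mem_image_of_mem _ hu)⟩

theorem exists_totalEmission_eq (hlam : 0 < lam) (hμ : 0 < μ) (hν : 0 < ν) (hT : 0 < T)
    {κ₀ B u : ℝ} (hu : u ∈ Icc (0 : ℝ) 1) (h : totalEmission lam μ ν T κ₀ u ≤ B) :
    ∃ κ, κ₀ ≤ κ ∧ totalEmission lam μ ν T κ u = B := by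
  obtain ⟨κ₁, h1, h2⟩ :=
    ((eventually_le_totalEmission hlam hμ hν hT B).and (eventually_ge_atTop κ₀)).exists
  have hc : Continuous fun κ => totalEmission lam μ ν T κ u :=
    (continuous_totalEmission hlam hμ hν hT).comp (continuous_id.prodMk continuous_const)
  obtain ⟨κ, hκ, hB⟩ := intermediate_value_Icc h2 hc.continuousOn ⟨h, h1 u hu⟩
  exact ⟨κ, hκ.1, hB⟩

end

end Emission

/-! ### Choice of the threshold for the total emission -/

theorem theorem3 (lam μ ν T : ℝ) (hlam : 0 < lam) (hμ : 0 < μ) (hν : 0 < ν) (hT : 0 < T) :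
    ∀ ε : ℝ, 0 < ε → ∃ B₀ : ℝ, ∀ B : ℝ, B₀ ≤ B → ∀ u ∈ Set.Icc (0 : ℝ) 1,
      ∀ S : Set ℝ, (S = {B} ∨ S = Set.Ici B) →
        (∃ x : EmissionPath, IsOptimalPath lam μ ν T u S x) ∧
        ∀ x : EmissionPath, IsOptimalPath lam μ ν T u S x →
          0 < x.x₃ T ∧ |x.x₂ T / x.x₃ T| < ε := by
  intro ε hε
  -- The ratio `μ e^(-κ) / (2 ν)` is below `ε` once `e^κ > μ / (2 ν ε)`; by `e^κ ≥ κ + 1` it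
  -- suffices that `κ` is at least this number, which also ensures `κ ≥ 0`.
  have hκ₀ : 0 < μ / (2 * ν * ε) := by positivity
  obtain ⟨C, hC⟩ := Emission.exists_totalEmission_bound hlam hμ hν hT (μ / (2 * ν * ε))
  -- `C` starts the intermediate value argument at `κ₀` for every `u`; the `1` makes `B` positive,
  -- which later gives `Q > 0`.
  refine ⟨max 1 C, fun B hB u hu S hS => ?_⟩
  have hB0 : 0 < B := zero_lt_one.trans_le ((le_max_left _ _).trans hB)
  have hmem : B ∈ S := by rcases hS with rfl | rfl <;> simp
  have hlow : ∀ b ∈ S, B ≤ b := by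
    rcases hS with rfl | rfl
    · exact fun b hb => (mem_singleton_iff.1 hb).ge
    · exact fun b hb => hb
  obtain ⟨κ, hκ, hF⟩ := Emission.exists_totalEmission_eq hlam hμ hν hT hu
    ((hC u hu).trans ((le_max_right _ _).trans hB))
  have hopt := (Emission.isExtremal_extremal hlam hμ hν hT κ hu).optimal hlam.le hμ.le hν.le hT
    (hκ₀.le.trans hκ) (Emission.isCostate_costate hlam hμ hν κ)
    (Emission.isAdmissiblePath_extremal hlam hμ hν hT κ hu
      (hF.symm.subst (motive := fun b => b ∈ S) hmem)) hF hlow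
  refine ⟨⟨_, hopt.1⟩, fun x hx => ?_⟩
  obtain ⟨Q, h2, h3⟩ := hopt.2 x hx
  have hsum := hB0.trans_le (hlow _ hx.1.emission_mem)
  have hQ : 0 < Q := by
    rw [h2, h3] at hsum
    have : 0 < (μ * Real.exp κ + 2 * (ν * Real.exp (2 * κ))) * Q := by linarith
    exact pos_of_mul_pos_right this (by positivity)
  have hx3 : 0 < x.x₃ T := by rw [h3]; positivity
  refine ⟨hx3, ?_⟩
  have hE : Real.exp (2 * κ) = Real.exp κ * Real.exp κ := by rw [← Real.exp_add]; ring_nf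
  have hlt : μ / (2 * ν * ε) < Real.exp κ := by linarith [Real.add_one_le_exp κ]
  rw [div_lt_iff₀ (by positivity)] at hlt
  rw [abs_of_nonneg (div_nonneg (by rw [h2]; positivity) hx3.le), div_lt_iff₀ hx3, h2, h3, hE]
  have := mul_lt_mul_of_pos_right hlt (mul_pos (Real.exp_pos κ) hQ)
  linarith
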